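/- Let $(\mathcal A;\mathcal E)$ be an exact category in the sense of Quillen: $\mathcal A$ is an additive category and $\mathcal E$ is a class of kernel-cokernel pairs $B\xrightarrow{m}C\xrightarrow{p}A$, called conflations ($m$ is an inflation, $p$ a deflation), closed under isomorphism, such that identities are inflations and deflations, inflations and deflations are closed under composition, pushouts of inflations along arbitrary morphisms exist and are inflations, and pullbacks of deflations along arbitrary morphisms exist and are deflations. Let $\operatorname{Ext}(A,B)$ be the set of equivalence classes of conflations $B\to C\to A$, with zero the class of the split one. Morphisms $a:A_0\to A_1$ and $b:B_0\to B_1$ are Ext-orthogonal if the map $\operatorname{Ext}(a,b):\operatorname{Ext}(A_1,B_0)\to\operatorname{Ext}(A_0,B_1)$ (pull back along $a$, push out along $b$) is zero. An ideal of $\mathcal A$ is an additive subbifunctor of $\operatorname{Hom}$. For an ideal $\mathcal I$, let $\mathcal I^{\perp}$ be the ideal of all $b$ that are Ext-orthogonal to (on the right of) every $a\in\mathcal I$, and for an ideal $\mathcal J$ let ${}^{\perp}\mathcal J$ be the ideal of all $a$ that are Ext-orthogonal to (on the left of) every $b\in\mathcal J$. A special $\mathcal J$-preenvelope of $B$ is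 a morphism $j:B\to C_0$ in $\mathcal J$ that is the inflation of the first conflation in a morphism of conflations $(B\xrightarrow{j}C_0\to A_0)\to(B\to C_1\to A_1)$ that is the identity on $B$ and whose component $A_0\to A_1$ lies in ${}^{\perp}\mathcal J$. Dually, a special $\mathcal I$-precover of $A$ is a morphism $i:C_1\to A$ in $\mathcal I$ that is the deflation of the second conflation in a morphism of conflations $(B_0\to C_0\to A)\to(B_1\to C_1\xrightarrow{i}A)$ that is the identity on $A$ and whose component $B_0\to B_1$ lies in $\mathcal I^{\perp}$. A pair of ideals $(\mathcal I,\mathcal J)$ is a complete (ideal) cotorsion pair if $\mathcal I={}^{\perp}\mathcal J$, $\mathcal J=\mathcal I^{\perp}$, every object has a special $\mathcal I$-precover, and every object has a special $\mathcal J$-preenvelope. A morphism is projective (injective) if it is left (right) Ext-orthogonal to every morphism of $\mathcal A$; $\mathcal E\text{-proj}$ denotes the ideal of projective morphisms. $(\mathcal A;\mathcal E)$ has enough projective morphisms if every object is the codomain of a deflation that is a projective morphism, and enough injective morphisms if every object is the domain of an inflation that is an injective morphism. A morphism $c:C_0\to C_1$ is an ME-extension $b\star a$ of $a:A_0\to A_1$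 by $b:B_0\to B_1$ if there are conflations $B_0\to C_0\to A_0$, $B_0\to C\to A_1$, $B_1\to C_1\to A_1$ and a factorization $c=c_2c_1$ such that $(1_{B_0},c_1,a)$ is a morphism from the first conflation to the second and $(b,c_2,1_{A_1})$ is a morphism from the second to the third. For an ideal $\mathcal K$, $\mathcal E\text{-proj}\diamond\mathcal K$ denotes the ideal generated by all ME-extensions $p\star k$ with $p$ projective and $k\in\mathcal K$. Corollary. Suppose that $(\mathcal A;\mathcal E)$ has enough projective and enough injective morphisms. If $(\mathcal I_1,\mathcal I_1^{\perp})$ and $(\mathcal I_2,\mathcal I_2^{\perp})$ are complete cotorsion pairs, then so is $$\bigl(\mathcal E\text{-proj}\diamond(\mathcal I_1+\mathcal I_2),\ \mathcal I_1^{\perp}\cap\mathcal I_2^{\perp}\bigr).$$ -/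

import Mathlib

open CategoryTheory CategoryTheory.Limits

universe v u

namespace IdealApprox

/-- `m`, `p` is a kernel-cokernel pair: `m` is a kernel of `p` and `p` is a cokernel of `m`. -/
def IsKernelCokernelPair {C : Type u} [Category.{v} C] [Preadditive C] {X Y Z : C}
    (m : X ⟶ Y) (p : Y ⟶ Z) : Prop :=
  ∃ w : m ≫ p = 0,
    Nonempty (IsLimit (KernelFork.ofι m w)) ∧ Nonempty (IsColimit (CokernelCofork.ofπ p w))

/-- A Quillen exact structure on an additive category (Keller's terminology): a class of
kernel-cokernel pairs, called conflations, closed under isomorphism and satisfying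
`E₀`, `E₁`, `E₂` and their duals. -/
structure ExactStructure (C : Type u) [Category.{v} C] [Preadditive C]
    [HasZeroObject C] [HasBinaryBiproducts C] where
  /-- `conf m p`: the pair `X ⟶ Y ⟶ Z` is a conflation. -/
  conf : ∀ {X Y Z : C}, (X ⟶ Y) → (Y ⟶ Z) → Prop
  pair : ∀ {X Y Z : C} {m : X ⟶ Y} {p : Y ⟶ Z}, conf m p → IsKernelCokernelPair m p
  iso_closed : ∀ {X Y Z X' Y' Z' : C} {m : X ⟶ Y} {p : Y ⟶ Z} {m' : X' ⟶ Y'} {p' : Y' ⟶ Z'}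
    (e₁ : X ≅ X') (e₂ : Y ≅ Y') (e₃ : Z ≅ Z'), m ≫ e₂.hom = e₁.hom ≫ m' →
    p ≫ e₃.hom = e₂.hom ≫ p' → conf m p → conf m' p'
  id_inflation : ∀ X : C, ∃ (Z : C) (p : X ⟶ Z), conf (𝟙 X) p
  id_deflation : ∀ X : C, ∃ (K : C) (m : K ⟶ X), conf m (𝟙 X)
  comp_inflation : ∀ {X Y Z : C} (m : X ⟶ Y) (n : Y ⟶ Z),
    (∃ (W : C) (p : Y ⟶ W), conf m p) → (∃ (W : C) (p : Z ⟶ W), conf n p) →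
    ∃ (W : C) (p : Z ⟶ W), conf (m ≫ n) p
  comp_deflation : ∀ {X Y Z : C} (p : X ⟶ Y) (q : Y ⟶ Z),
    (∃ (W : C) (m : W ⟶ X), conf m p) → (∃ (W : C) (m : W ⟶ Y), conf m q) →
    ∃ (W : C) (m : W ⟶ X), conf m (p ≫ q)
  pushout_inflation : ∀ {X Y X' : C} (m : X ⟶ Y) (f : X ⟶ X'),
    (∃ (W : C) (p : Y ⟶ W), conf m p) →
    ∃ (Y' : C) (g : Y ⟶ Y') (m' : X' ⟶ Y'), IsPushout m f g m' ∧
      ∃ (W : C) (p : Y' ⟶ W), conf m' p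
  pullback_deflation : ∀ {Y Z Z' : C} (p : Y ⟶ Z) (f : Z' ⟶ Z),
    (∃ (W : C) (m : W ⟶ Y), conf m p) →
    ∃ (Y' : C) (g : Y' ⟶ Y) (p' : Y' ⟶ Z'), IsPullback g p' p f ∧
      ∃ (W : C) (m : W ⟶ Y'), conf m p'

variable {C : Type u} [Category.{v} C] [Preadditive C]

section Pairs

theorem IsKernelCokernelPair.w {X Y Z : C} {m : X ⟶ Y} {p : Y ⟶ Z}
    (h : IsKernelCokernelPair m p) : m ≫ p = 0 := h.1

theorem IsKernelCokernelPair.mono {X Y Z : C} {m : X ⟶ Y} {p : Y ⟶ Z}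
    (h : IsKernelCokernelPair m p) : Mono m := by
  obtain ⟨w, ⟨l⟩, _⟩ := h
  exact Fork.IsLimit.mono l

theorem IsKernelCokernelPair.epi {X Y Z : C} {m : X ⟶ Y} {p : Y ⟶ Z}
    (h : IsKernelCokernelPair m p) : Epi p := by
  obtain ⟨w, _, ⟨l⟩⟩ := h
  exact Cofork.IsColimit.epi l

theorem IsKernelCokernelPair.exists_lift {X Y Z : C} {m : X ⟶ Y} {p : Y ⟶ Z}
    (h : IsKernelCokernelPair m p) {W : C} (k : W ⟶ Y) (hk : k ≫ p = 0) :
    ∃ l : W ⟶ X, l ≫ m = k := by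
  obtain ⟨w, ⟨l⟩, _⟩ := h
  exact ⟨(KernelFork.IsLimit.lift' l k hk).1, (KernelFork.IsLimit.lift' l k hk).2⟩

theorem IsKernelCokernelPair.exists_desc {X Y Z : C} {m : X ⟶ Y} {p : Y ⟶ Z}
    (h : IsKernelCokernelPair m p) {W : C} (k : Y ⟶ W) (hk : m ≫ k = 0) :
    ∃ l : Z ⟶ W, p ≫ l = k := by
  obtain ⟨w, _, ⟨l⟩⟩ := h
  exact ⟨(CokernelCofork.IsColimit.desc' l k hk).1, (CokernelCofork.IsColimit.desc' l k hk).2⟩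

end Pairs

variable [HasZeroObject C] [HasBinaryBiproducts C]

namespace ExactStructure

variable (E : ExactStructure C)

/-- A morphism is an inflation if it is the first morphism of a conflation. -/
def Inflation {X Y : C} (m : X ⟶ Y) : Prop := ∃ (Z : C) (p : Y ⟶ Z), E.conf m p

/-- A morphism is a deflation if it is the second morphism of a conflation. -/
def Deflation {Y Z : C} (p : Y ⟶ Z) : Prop := ∃ (X : C) (m : X ⟶ Y), E.conf m p

variable {E}

/-- A kernel of a deflation forms a conflation with it. -/
theorem Deflation.conf_of_kernel {X Y Z : C} {m : X ⟶ Y} {p : Y ⟶ Z} (h : E.Deflation p)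
    [Mono m] (w : m ≫ p = 0)
    (hl : ∀ {W : C} (k : W ⟶ Y), k ≫ p = 0 → ∃ l : W ⟶ X, l ≫ m = k) : E.conf m p := by
  obtain ⟨K, n, hn⟩ := h
  have hp := E.pair hn
  have := hp.mono
  obtain ⟨a, ha⟩ := hl n hp.w
  obtain ⟨b, hb⟩ := hp.exists_lift m w
  refine E.iso_closed ⟨a, b, ?_, ?_⟩ (Iso.refl _) (Iso.refl _) ?_ ?_ hn
  · rw [← cancel_mono n, Category.assoc, hb, ha, Category.id_comp]
  · rw [← cancel_mono m, Category.assoc, ha, hb, Category.id_comp]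
  · simp [ha]
  · simp

/-- A cokernel of an inflation forms a conflation with it. -/
theorem Inflation.conf_of_cokernel {X Y Z : C} {m : X ⟶ Y} {p : Y ⟶ Z} (h : E.Inflation m)
    [Epi p] (w : m ≫ p = 0)
    (hl : ∀ {W : C} (k : Y ⟶ W), m ≫ k = 0 → ∃ l : Z ⟶ W, p ≫ l = k) : E.conf m p := by
  obtain ⟨K, n, hn⟩ := h
  have hp := E.pair hn
  have := hp.epi
  obtain ⟨a, ha⟩ := hl n hp.w
  obtain ⟨b, hb⟩ := hp.exists_desc p w
  refine E.iso_closed (Iso.refl _) (Iso.refl _) ⟨b, a, ?_, ?_⟩ ?_ ?_ hn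
  · rw [← cancel_epi n, ← Category.assoc, hb, ha, Category.comp_id]
  · rw [← cancel_epi p, ← Category.assoc, ha, hb, Category.comp_id]
  · simp
  · simp [hb]

/-- Split short exact sequences are conflations. -/
theorem conf_biprod (E : ExactStructure C) (B A : C) :
    E.conf (biprod.inl : B ⟶ B ⊞ A) (biprod.snd : B ⊞ A ⟶ A) := by
  -- the morphism from a zero object to `A` is an inflation
  obtain ⟨K, m, hm⟩ := E.id_deflation A
  have hm0 : m = 0 := by simpa using (E.pair hm).w
  have hK : ∀ {T : C} (f : K ⟶ T), f = 0 := by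
    intro T f
    have := (E.pair hm).mono
    have h1 : 𝟙 K = 0 := by rw [← cancel_mono m, hm0]; simp
    rw [← Category.id_comp f, h1, zero_comp]
  obtain ⟨Y, g, n, hpo, hn⟩ := E.pushout_inflation m (0 : K ⟶ B) ⟨_, _, hm⟩
  have hinfl : E.Inflation (biprod.inl : B ⟶ B ⊞ A) := by
    obtain ⟨W, q, hq⟩ := hn
    have e1 : n ≫ hpo.desc (biprod.inr : A ⟶ B ⊞ A) biprod.inl (by rw [hK (m ≫ _), zero_comp])
        = biprod.inl := hpo.inr_desc _ _ _
    have e2 : g ≫ hpo.desc (biprod.inr : A ⟶ B ⊞ A) biprod.inl (by rw [hK (m ≫ _), zero_comp])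
        = biprod.inr := hpo.inl_desc _ _ _
    refine ⟨W, biprod.desc n g ≫ q, ?_⟩
    refine E.iso_closed (Iso.refl _)
      ⟨hpo.desc (biprod.inr : A ⟶ B ⊞ A) biprod.inl (by rw [hK (m ≫ _), zero_comp]),
        biprod.desc n g, ?_, ?_⟩ (Iso.refl _) ?_ ?_ hq
    · apply hpo.hom_ext
      · rw [← Category.assoc, e2]; simp
      · rw [← Category.assoc, e1]; simp
    · apply biprod.hom_ext'
      · rw [← Category.assoc, biprod.inl_desc, e1]; simp
      · rw [← Category.assoc, biprod.inr_desc, e2]; simp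
    · simp
    · simp only [Iso.refl_hom, Category.comp_id]
      apply hpo.hom_ext
      · rw [← Category.assoc, e2]; simp
      · rw [← Category.assoc, e1]; simp
  refine hinfl.conf_of_cokernel (by simp) ?_
  intro W k hk
  refine ⟨biprod.inr ≫ k, ?_⟩
  apply biprod.hom_ext' <;> simp [hk]

variable (E)

/-- A conflation `B ⟶ mid ⟶ A` with prescribed ends. -/
structure Extension (A B : C) where
  mid : C
  i : B ⟶ mid
  p : mid ⟶ A
  conf : E.conf i p

variable {E}

namespace Extension

/-- Equivalence of extensions: an isomorphism that is the identity on both ends. -/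
def Equiv {A B : C} (X Y : E.Extension A B) : Prop :=
  ∃ e : X.mid ≅ Y.mid, X.i ≫ e.hom = Y.i ∧ e.hom ≫ Y.p = X.p

theorem equiv_equivalence {A B : C} : Equivalence (Equiv (E := E) (A := A) (B := B)) where
  refl X := ⟨Iso.refl _, by simp, by simp⟩
  symm := by
    rintro X Y ⟨e, h1, h2⟩
    exact ⟨e.symm, by simp [← h1], by simp [← h2]⟩
  trans := by
    rintro X Y Z ⟨e, h1, h2⟩ ⟨f, h3, h4⟩
    exact ⟨e ≪≫ f, by simp [reassoc_of% h1, h3], by simp [h4, h2]⟩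

instance setoid (A B : C) : Setoid (E.Extension A B) := ⟨Equiv, equiv_equivalence⟩

/-- The split extension of `A` by `B`. -/
noncomputable abbrev split (E : ExactStructure C) (A B : C) : E.Extension A B where
  mid := B ⊞ A
  i := biprod.inl
  p := biprod.snd
  conf := E.conf_biprod B A

/-- `X'` is obtained from `X` by pulling back along `a`. -/
def IsPullbackOf {A A' B : C} (a : A' ⟶ A) (X' : E.Extension A' B) (X : E.Extension A B) :
    Prop :=
  ∃ g : X'.mid ⟶ X.mid, X'.i ≫ g = X.i ∧ IsPullback g X'.p X.p a

/-- `X'` is obtained from `X` by pushing out along `b`. -/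
def IsPushoutOf {A B B' : C} (b : B ⟶ B') (X' : E.Extension A B') (X : E.Extension A B) :
    Prop :=
  ∃ h : X.mid ⟶ X'.mid, h ≫ X'.p = X.p ∧ IsPushout X.i b h X'.i

theorem exists_pullback {A A' B : C} (a : A' ⟶ A) (X : E.Extension A B) :
    ∃ X' : E.Extension A' B, IsPullbackOf a X' X := by
  obtain ⟨Y, g, q, hpb, hq⟩ := E.pullback_deflation X.p a ⟨_, _, X.conf⟩
  have hX := E.pair X.conf
  have := hX.mono
  have w : X.i ≫ X.p = (0 : B ⟶ A') ≫ a := by rw [hX.w, zero_comp]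
  have e1 : hpb.lift X.i 0 w ≫ g = X.i := hpb.lift_fst _ _ _
  have e2 : hpb.lift X.i 0 w ≫ q = 0 := hpb.lift_snd _ _ _
  have : Mono (hpb.lift X.i 0 w) := by
    have : Mono (hpb.lift X.i 0 w ≫ g) := by rw [e1]; infer_instance
    exact mono_of_mono _ g
  refine ⟨⟨Y, hpb.lift X.i 0 w, q, Deflation.conf_of_kernel hq e2 ?_⟩, g, e1, hpb⟩
  intro W k hk
  obtain ⟨l, hl⟩ := hX.exists_lift (k ≫ g)
    (by rw [Category.assoc, hpb.w, ← Category.assoc, hk, zero_comp])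
  refine ⟨l, hpb.hom_ext ?_ ?_⟩
  · rw [Category.assoc, e1, hl]
  · rw [Category.assoc, e2, comp_zero, hk]

theorem exists_pushout {A B B' : C} (b : B ⟶ B') (X : E.Extension A B) :
    ∃ X' : E.Extension A B', IsPushoutOf b X' X := by
  obtain ⟨Y, g, m, hpo, hm⟩ := E.pushout_inflation X.i b ⟨_, _, X.conf⟩
  have hX := E.pair X.conf
  have := hX.epi
  have w : X.i ≫ X.p = b ≫ (0 : B' ⟶ A) := by rw [hX.w, comp_zero]
  have e1 : g ≫ hpo.desc X.p 0 w = X.p := hpo.inl_desc _ _ _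
  have e2 : m ≫ hpo.desc X.p 0 w = 0 := hpo.inr_desc _ _ _
  have : Epi (hpo.desc X.p 0 w) := by
    have : Epi (g ≫ hpo.desc X.p 0 w) := by rw [e1]; infer_instance
    exact epi_of_epi g _
  refine ⟨⟨Y, m, hpo.desc X.p 0 w, Inflation.conf_of_cokernel hm e2 ?_⟩, g, e1, hpo⟩
  intro W k hk
  obtain ⟨l, hl⟩ := hX.exists_desc (g ≫ k)
    (by rw [← Category.assoc, hpo.w, Category.assoc, hk, comp_zero])
  refine ⟨l, hpo.hom_ext ?_ ?_⟩
  · rw [← Category.assoc, e1, hl]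
  · rw [← Category.assoc, e2, zero_comp, hk]

/-- A chosen pullback of an extension. -/
noncomputable def pull {A A' B : C} (a : A' ⟶ A) (X : E.Extension A B) : E.Extension A' B :=
  (exists_pullback a X).choose

theorem pull_spec {A A' B : C} (a : A' ⟶ A) (X : E.Extension A B) :
    IsPullbackOf a (pull a X) X := (exists_pullback a X).choose_spec

/-- A chosen pushout of an extension. -/
noncomputable def push {A B B' : C} (b : B ⟶ B') (X : E.Extension A B) : E.Extension A B' :=
  (exists_pushout b X).choose

theorem push_spec {A B B' : C} (b : B ⟶ B') (X : E.Extension A B) :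
    IsPushoutOf b (push b X) X := (exists_pushout b X).choose_spec

theorem IsPullbackOf.equiv {A A' B : C} {a : A' ⟶ A} {X Y : E.Extension A B}
    {X' Y' : E.Extension A' B} (hX : IsPullbackOf a X' X) (hY : IsPullbackOf a Y' Y)
    (h : Equiv X Y) : Equiv X' Y' := by
  obtain ⟨g, hg, pg⟩ := hX
  obtain ⟨k, hk, pk⟩ := hY
  obtain ⟨e, h1, h2⟩ := h
  have w1 : (g ≫ e.hom) ≫ Y.p = X'.p ≫ a := by rw [Category.assoc, h2, pg.w]
  have w2 : (k ≫ e.inv) ≫ X.p = Y'.p ≫ a := by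
    rw [Category.assoc, ← h2, e.inv_hom_id_assoc, pk.w]
  refine ⟨⟨pk.lift _ _ w1, pg.lift _ _ w2, pg.hom_ext ?_ ?_, pk.hom_ext ?_ ?_⟩,
    pk.hom_ext ?_ ?_, ?_⟩
  · simp
  · simp
  · simp
  · simp
  · simp [reassoc_of% hg, h1, hk]
  · simp [(E.pair X'.conf).w, (E.pair Y'.conf).w]
  · simp

theorem IsPushoutOf.equiv {A B B' : C} {b : B ⟶ B'} {X Y : E.Extension A B}
    {X' Y' : E.Extension A B'} (hX : IsPushoutOf b X' X) (hY : IsPushoutOf b Y' Y)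
    (h : Equiv X Y) : Equiv X' Y' := by
  obtain ⟨g, hg, pg⟩ := hX
  obtain ⟨k, hk, pk⟩ := hY
  obtain ⟨e, h1, h2⟩ := h
  have w1 : X.i ≫ (e.hom ≫ k) = b ≫ Y'.i := by rw [← Category.assoc, h1, pk.w]
  have w2 : Y.i ≫ (e.inv ≫ g) = b ≫ X'.i := by
    rw [← h1, Category.assoc, e.hom_inv_id_assoc, pg.w]
  refine ⟨⟨pg.desc _ _ w1, pk.desc _ _ w2, pg.hom_ext ?_ ?_, pk.hom_ext ?_ ?_⟩,
    ?_, pg.hom_ext ?_ ?_⟩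
  · simp
  · simp
  · simp
  · simp
  · simp
  · simp [hk, h2, hg]
  · simp [(E.pair X'.conf).w, (E.pair Y'.conf).w]

/-- An extension whose inflation has a retraction is equivalent to the split one. -/
theorem equiv_split_of_retraction {A B : C} (X : E.Extension A B) (r : X.mid ⟶ B)
    (hr : X.i ≫ r = 𝟙 B) : Equiv X (split E A B) := by
  have hX := E.pair X.conf
  have := hX.epi
  obtain ⟨s, hs⟩ := hX.exists_desc (𝟙 X.mid - r ≫ X.i) (by
    rw [Preadditive.comp_sub, reassoc_of% hr, Category.comp_id, sub_self])
  have hsp : s ≫ X.p = 𝟙 A := by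
    rw [← cancel_epi X.p, ← Category.assoc, hs, Preadditive.sub_comp, Category.assoc, hX.w]
    simp
  have hsr : s ≫ r = 0 := by
    rw [← cancel_epi X.p, ← Category.assoc, hs, Preadditive.sub_comp, Category.assoc, hr]
    simp
  refine ⟨⟨biprod.lift r X.p, biprod.desc X.i s, ?_, ?_⟩, ?_, ?_⟩
  · rw [biprod.lift_desc, hs]; abel
  · apply biprod.hom_ext'
    · apply biprod.hom_ext <;> simp [split, hr, hX.w]
    · apply biprod.hom_ext <;> simp [split, hsr, hsp]
  · apply biprod.hom_ext <;> simp [split, hr, hX.w]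
  · simp [split]

end Extension

variable (E)

/-- `Ext(A, B)`: equivalence classes of conflations `B ⟶ X ⟶ A`. -/
def Ext (A B : C) := Quotient (Extension.setoid (E := E) A B)

/-- The zero of `Ext(A, B)` (for the Baer sum) is the class of the split conflation. -/
noncomputable instance (A B : C) : Zero (E.Ext A B) := ⟨Quotient.mk _ (Extension.split E A B)⟩

/-- `Ext(a, B) : Ext(A, B) → Ext(A', B)`, by pullback along `a : A' ⟶ A`. -/
noncomputable def extPull {A A' : C} (a : A' ⟶ A) (B : C) : E.Ext A B → E.Ext A' B :=
  Quotient.map (Extension.pull a) fun X Y h =>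
    (Extension.pull_spec a X).equiv (Extension.pull_spec a Y) h

/-- `Ext(A, b) : Ext(A, B) → Ext(A, B')`, by pushout along `b : B ⟶ B'`. -/
noncomputable def extPush (A : C) {B B' : C} (b : B ⟶ B') : E.Ext A B → E.Ext A B' :=
  Quotient.map (Extension.push b) fun X Y h =>
    (Extension.push_spec b X).equiv (Extension.push_spec b Y) h

/-- `Ext(a, b) : Ext(A₁, B₀) → Ext(A₀, B₁)` for `a : A₀ ⟶ A₁` and `b : B₀ ⟶ B₁`. -/
noncomputable def extMap {A₀ A₁ B₀ B₁ : C} (a : A₀ ⟶ A₁) (b : B₀ ⟶ B₁) :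
    E.Ext A₁ B₀ → E.Ext A₀ B₁ :=
  fun ξ => E.extPush A₀ b (E.extPull a B₀ ξ)

/-- `a` and `b` are Ext-orthogonal: the map `Ext(a, b)` is zero. -/
def ExtOrthogonal {A₀ A₁ B₀ B₁ : C} (a : A₀ ⟶ A₁) (b : B₀ ⟶ B₁) : Prop :=
  ∀ ξ : E.Ext A₁ B₀, E.extMap a b ξ = 0

variable {E}

theorem extPush_mk_eq_zero_iff {A B B' : C} (b : B ⟶ B') (X : E.Extension A B) :
    E.extPush A b (Quotient.mk _ X) = 0 ↔ ∃ r : X.mid ⟶ B', X.i ≫ r = b := by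
  obtain ⟨h, hp, hpo⟩ := Extension.push_spec b X
  have key : E.extPush A b (Quotient.mk _ X) = 0 ↔
      Extension.Equiv (Extension.push b X) (Extension.split E A B') :=
    ⟨fun h => Quotient.exact h, fun h => Quotient.sound h⟩
  rw [key]
  constructor
  · rintro ⟨e, h1, -⟩
    have h2 : (Extension.push b X).i ≫ e.hom ≫ (biprod.fst : B' ⊞ A ⟶ B') = 𝟙 B' := by
      rw [← Category.assoc]
      exact (congrArg (fun t => t ≫ (biprod.fst : B' ⊞ A ⟶ B')) h1).trans biprod.inl_fst
    exact ⟨h ≫ e.hom ≫ (biprod.fst : B' ⊞ A ⟶ B'), by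
      rw [← Category.assoc, hpo.w, Category.assoc, h2, Category.comp_id]⟩
  · rintro ⟨r, hr⟩
    exact Extension.equiv_split_of_retraction _ (hpo.desc r (𝟙 _) (by simp [hr])) (by simp)

/-- Ext-orthogonality through extensions along pulled back inflations. -/
theorem extOrthogonal_iff {A₀ A₁ B₀ B₁ : C} (a : A₀ ⟶ A₁) (b : B₀ ⟶ B₁) :
    E.ExtOrthogonal a b ↔ ∀ (X : E.Extension A₁ B₀) (X' : E.Extension A₀ B₀),
      Extension.IsPullbackOf a X' X → ∃ r : X'.mid ⟶ B₁, X'.i ≫ r = b := by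
  constructor
  · intro h X X' hX
    have h1 := (extPush_mk_eq_zero_iff b (Extension.pull a X)).1 (h (Quotient.mk _ X))
    obtain ⟨r, hr⟩ := h1
    obtain ⟨e, he, -⟩ := hX.equiv (Extension.pull_spec a X) (Extension.equiv_equivalence.refl X)
    exact ⟨e.hom ≫ r, by rw [← Category.assoc, he, hr]⟩
  · intro h ξ
    induction ξ using Quotient.inductionOn with
    | _ X =>
      exact (extPush_mk_eq_zero_iff b (Extension.pull a X)).2 (h X _ (Extension.pull_spec a X))

/-- Ext-orthogonality through lifts along pushed out deflations. -/
theorem extOrthogonal_iff' {A₀ A₁ B₀ B₁ : C} (a : A₀ ⟶ A₁) (b : B₀ ⟶ B₁) :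
    E.ExtOrthogonal a b ↔ ∀ (X : E.Extension A₁ B₀) (Z : E.Extension A₁ B₁),
      Extension.IsPushoutOf b Z X → ∃ t : A₀ ⟶ Z.mid, t ≫ Z.p = a := by
  rw [extOrthogonal_iff]
  constructor
  · intro H X Z ⟨h, hh, hpo⟩
    obtain ⟨X', hX'⟩ := Extension.exists_pullback a X
    obtain ⟨r, hr⟩ := H X X' hX'
    obtain ⟨g, hg, hpb⟩ := hX'
    have hp := E.pair X'.conf
    have := hp.epi
    obtain ⟨t, ht⟩ := hp.exists_desc (g ≫ h - r ≫ Z.i) (by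
      rw [Preadditive.comp_sub, reassoc_of% hg, reassoc_of% hr, hpo.w, sub_self])
    refine ⟨t, ?_⟩
    rw [← cancel_epi X'.p, ← Category.assoc, ht, Preadditive.sub_comp, Category.assoc,
      Category.assoc, (E.pair Z.conf).w, hh, hpb.w, comp_zero, sub_zero]
  · intro H X X' ⟨g, hg, hpb⟩
    obtain ⟨Z, hZ⟩ := Extension.exists_pushout b X
    obtain ⟨t, ht⟩ := H X Z hZ
    obtain ⟨h, hh, hpo⟩ := hZ
    have hp := E.pair Z.conf
    have := hp.mono
    obtain ⟨r, hr⟩ := hp.exists_lift (g ≫ h - X'.p ≫ t) (by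
      rw [Preadditive.sub_comp, Category.assoc, Category.assoc, hh, ht, hpb.w, sub_self])
    refine ⟨r, ?_⟩
    rw [← cancel_mono Z.i, Category.assoc, hr, Preadditive.comp_sub, reassoc_of% hg, hpo.w,
      ← Category.assoc X'.i, (E.pair X'.conf).w, zero_comp, sub_zero]

theorem ExtOrthogonal.add_right {A₀ A₁ B₀ B₁ : C} {a : A₀ ⟶ A₁} {b b' : B₀ ⟶ B₁}
    (h : E.ExtOrthogonal a b) (h' : E.ExtOrthogonal a b') : E.ExtOrthogonal a (b + b') := by
  rw [extOrthogonal_iff] at *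
  intro X X' hX
  obtain ⟨r, hr⟩ := h X X' hX
  obtain ⟨r', hr'⟩ := h' X X' hX
  exact ⟨r + r', by simp [hr, hr']⟩

theorem ExtOrthogonal.neg_right {A₀ A₁ B₀ B₁ : C} {a : A₀ ⟶ A₁} {b : B₀ ⟶ B₁}
    (h : E.ExtOrthogonal a b) : E.ExtOrthogonal a (-b) := by
  rw [extOrthogonal_iff] at *
  intro X X' hX
  obtain ⟨r, hr⟩ := h X X' hX
  exact ⟨-r, by simp [hr]⟩

theorem extOrthogonal_zero_right {A₀ A₁ : C} (a : A₀ ⟶ A₁) (B₀ B₁ : C) :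
    E.ExtOrthogonal a (0 : B₀ ⟶ B₁) := by
  rw [extOrthogonal_iff]
  intro X X' hX
  exact ⟨0, by simp⟩

theorem ExtOrthogonal.comp_right {A₀ A₁ B B₀ B₁ B' : C} {a : A₀ ⟶ A₁} {b : B₀ ⟶ B₁}
    (h : E.ExtOrthogonal a b) (f : B ⟶ B₀) (g : B₁ ⟶ B') :
    E.ExtOrthogonal a (f ≫ b ≫ g) := by
  rw [extOrthogonal_iff] at *
  intro X X' ⟨x, hx, hpb⟩
  obtain ⟨Y, y, hy, hpo⟩ := Extension.exists_pushout f X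
  obtain ⟨Y', hY'⟩ := Extension.exists_pullback a Y
  obtain ⟨r, hr⟩ := h Y Y' hY'
  obtain ⟨z, hz, hpb'⟩ := hY'
  have w : (x ≫ y) ≫ Y.p = X'.p ≫ a := by rw [Category.assoc, hy, hpb.w]
  refine ⟨hpb'.lift (x ≫ y) X'.p w ≫ r ≫ g, ?_⟩
  have e : X'.i ≫ hpb'.lift (x ≫ y) X'.p w = f ≫ Y'.i := by
    apply hpb'.hom_ext
    · simp [reassoc_of% hx, hpo.w, hz]
    · simp [(E.pair X'.conf).w, (E.pair Y'.conf).w]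
  rw [reassoc_of% e, reassoc_of% hr]

theorem ExtOrthogonal.add_left {A₀ A₁ B₀ B₁ : C} {a a' : A₀ ⟶ A₁} {b : B₀ ⟶ B₁}
    (h : E.ExtOrthogonal a b) (h' : E.ExtOrthogonal a' b) : E.ExtOrthogonal (a + a') b := by
  rw [extOrthogonal_iff'] at *
  intro X X' hX
  obtain ⟨r, hr⟩ := h X X' hX
  obtain ⟨r', hr'⟩ := h' X X' hX
  exact ⟨r + r', by simp [hr, hr']⟩

theorem ExtOrthogonal.neg_left {A₀ A₁ B₀ B₁ : C} {a : A₀ ⟶ A₁} {b : B₀ ⟶ B₁}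
    (h : E.ExtOrthogonal a b) : E.ExtOrthogonal (-a) b := by
  rw [extOrthogonal_iff'] at *
  intro X X' hX
  obtain ⟨r, hr⟩ := h X X' hX
  exact ⟨-r, by simp [hr]⟩

theorem extOrthogonal_zero_left (A₀ A₁ : C) {B₀ B₁ : C} (b : B₀ ⟶ B₁) :
    E.ExtOrthogonal (0 : A₀ ⟶ A₁) b := by
  rw [extOrthogonal_iff']
  intro X X' hX
  exact ⟨0, by simp⟩

theorem ExtOrthogonal.comp_left {A A₀ A₁ A' B₀ B₁ : C} {a : A₀ ⟶ A₁} {b : B₀ ⟶ B₁}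
    (h : E.ExtOrthogonal a b) (f : A ⟶ A₀) (g : A₁ ⟶ A') :
    E.ExtOrthogonal (f ≫ a ≫ g) b := by
  rw [extOrthogonal_iff'] at *
  intro X Z ⟨x, hx, hpo⟩
  obtain ⟨Y, y, hy, hpb⟩ := Extension.exists_pullback g X
  obtain ⟨Y', hY'⟩ := Extension.exists_pushout b Y
  obtain ⟨t, ht⟩ := h Y Y' hY'
  obtain ⟨z, hz, hpo'⟩ := hY'
  have w : Y.i ≫ (y ≫ x) = b ≫ Z.i := by rw [← Category.assoc, hy, hpo.w]
  refine ⟨f ≫ t ≫ hpo'.desc (y ≫ x) Z.i w, ?_⟩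
  have e : hpo'.desc (y ≫ x) Z.i w ≫ Z.p = Y'.p ≫ g := by
    apply hpo'.hom_ext
    · simp [hx, hpb.w, reassoc_of% hz]
    · rw [← Category.assoc, hpo'.inr_desc, (E.pair Z.conf).w, ← Category.assoc,
        (E.pair Y'.conf).w, zero_comp]
  rw [Category.assoc, Category.assoc, e, reassoc_of% ht]

end ExactStructure

/-- An ideal of a preadditive category: an additive subbifunctor of `Hom`. -/
@[ext]
structure MorIdeal (C : Type u) [Category.{v} C] [Preadditive C] where
  hom : ∀ X Y : C, AddSubgroup (X ⟶ Y)
  comp_mem : ∀ {W X Y Z : C} (f : W ⟶ X) {a : X ⟶ Y} (g : Y ⟶ Z),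
    a ∈ hom X Y → f ≫ a ≫ g ∈ hom W Z

namespace MorIdeal

variable {C : Type u} [Category.{v} C] [Preadditive C]

/-- The morphism `a` belongs to the ideal `I`. -/
def Mem (I : MorIdeal C) {X Y : C} (a : X ⟶ Y) : Prop := a ∈ I.hom X Y

/-- The intersection of two ideals. -/
def inter (I J : MorIdeal C) : MorIdeal C where
  hom X Y := I.hom X Y ⊓ J.hom X Y
  comp_mem f _ g h := ⟨I.comp_mem f g h.1, J.comp_mem f g h.2⟩

/-- The sum of two ideals. -/
def sum (I J : MorIdeal C) : MorIdeal C where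
  hom X Y := I.hom X Y ⊔ J.hom X Y
  comp_mem f a g h := by
    obtain ⟨x, hx, y, hy, rfl⟩ := AddSubgroup.mem_sup.1 h
    exact AddSubgroup.mem_sup.2 ⟨f ≫ x ≫ g, I.comp_mem f g hx, f ≫ y ≫ g, J.comp_mem f g hy,
      by simp⟩

instance : Min (MorIdeal C) := ⟨inter⟩

instance : Add (MorIdeal C) := ⟨sum⟩

/-- The ideal generated by a class of morphisms: finite sums of morphisms `f ≫ a ≫ g`
with `a` in the class. -/
def span (M : MorphismProperty C) : MorIdeal C where
  hom X Y := AddSubgroup.closure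
    {x | ∃ (A B : C) (f : X ⟶ A) (a : A ⟶ B) (g : B ⟶ Y), M a ∧ x = f ≫ a ≫ g}
  comp_mem := by
    intro W X Y Z f a g h
    induction h using AddSubgroup.closure_induction with
    | mem x hx =>
      obtain ⟨A, B, f', a, g', ha, rfl⟩ := hx
      exact AddSubgroup.subset_closure ⟨A, B, f ≫ f', a, g' ≫ g, ha, by simp⟩
    | zero => simp
    | add x y _ _ hx hy => simpa using AddSubgroup.add_mem _ hx hy
    | neg x _ hx => simpa using AddSubgroup.neg_mem _ hx

end MorIdeal

namespace ExactStructure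

variable (E : ExactStructure C)

/-- `I^⊥`: the ideal of the morphisms `b` with `Ext(a, b) = 0` for all `a ∈ I`. -/
def rightPerp (I : MorIdeal C) : MorIdeal C where
  hom _ _ :=
    { carrier := {b | ∀ {A₀ A₁ : C} (a : A₀ ⟶ A₁), I.Mem a → E.ExtOrthogonal a b}
      add_mem' := fun h h' _ _ a ha => (h a ha).add_right (h' a ha)
      zero_mem' := fun a _ => extOrthogonal_zero_right a _ _
      neg_mem' := fun h _ _ a ha => (h a ha).neg_right }
  comp_mem f _ g h _ _ a ha := (h a ha).comp_right f g

/-- `^⊥J`: the ideal of the morphisms `a` with `Ext(a, b) = 0` for all `b ∈ J`. -/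
def leftPerp (J : MorIdeal C) : MorIdeal C where
  hom _ _ :=
    { carrier := {a | ∀ {B₀ B₁ : C} (b : B₀ ⟶ B₁), J.Mem b → E.ExtOrthogonal a b}
      add_mem' := fun h h' _ _ b hb => (h b hb).add_left (h' b hb)
      zero_mem' := fun b _ => extOrthogonal_zero_left _ _ b
      neg_mem' := fun h _ _ b hb => (h b hb).neg_left }
  comp_mem f _ g h _ _ b hb := (h b hb).comp_left f g

/-- The ideal of all morphisms. -/
def _root_.IdealApprox.MorIdeal.all (C : Type u) [Category.{v} C] [Preadditive C] :
    MorIdeal C where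
  hom _ _ := ⊤
  comp_mem _ _ _ _ := trivial

/-- The ideal of projective morphisms: those left Ext-orthogonal to every morphism. -/
def proj : MorIdeal C := E.leftPerp (MorIdeal.all C)

/-- The ideal of injective morphisms: those right Ext-orthogonal to every morphism. -/
def inj : MorIdeal C := E.rightPerp (MorIdeal.all C)

/-- Enough projective morphisms: every object is the codomain of a deflation which is a
projective morphism. -/
def EnoughProjectiveMorphisms : Prop :=
  ∀ A : C, ∃ (P : C) (p : P ⟶ A), E.Deflation p ∧ E.proj.Mem p

/-- Enough injective morphisms: every object is the domain of an inflation which is an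
injective morphism. -/
def EnoughInjectiveMorphisms : Prop :=
  ∀ B : C, ∃ (Q : C) (j : B ⟶ Q), E.Inflation j ∧ E.inj.Mem j

/-- `j : B ⟶ C₀` is a special `J`-preenvelope: it lies in `J` and it is the inflation in the top
row of a morphism of conflations `(B ⟶ C₀ ⟶ A₀) → (B ⟶ C₁ ⟶ A₁)` that is the identity on `B`
and whose component `a : A₀ ⟶ A₁` lies in `^⊥J`. -/
def IsSpecialPreenvelope (J : MorIdeal C) {B C₀ : C} (j : B ⟶ C₀) : Prop :=
  J.Mem j ∧ ∃ (A₀ C₁ A₁ : C) (p₀ : C₀ ⟶ A₀) (i₁ : B ⟶ C₁) (p₁ : C₁ ⟶ A₁)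
    (c : C₀ ⟶ C₁) (a : A₀ ⟶ A₁),
    E.conf j p₀ ∧ E.conf i₁ p₁ ∧ j ≫ c = i₁ ∧ p₀ ≫ a = c ≫ p₁ ∧ (E.leftPerp J).Mem a

/-- `i : C₁ ⟶ A` is a special `I`-precover: it lies in `I` and it is the deflation in the bottom
row of a morphism of conflations `(B₀ ⟶ C₀ ⟶ A) → (B₁ ⟶ C₁ ⟶ A)` that is the identity on `A`
and whose component `b : B₀ ⟶ B₁` lies in `I^⊥`. -/
def IsSpecialPrecover (I : MorIdeal C) {C₁ A : C} (i : C₁ ⟶ A) : Prop :=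
  I.Mem i ∧ ∃ (B₀ C₀ B₁ : C) (m₀ : B₀ ⟶ C₀) (p₀ : C₀ ⟶ A) (m₁ : B₁ ⟶ C₁)
    (b : B₀ ⟶ B₁) (c : C₀ ⟶ C₁),
    E.conf m₀ p₀ ∧ E.conf m₁ i ∧ m₀ ≫ c = b ≫ m₁ ∧ c ≫ i = p₀ ∧ (E.rightPerp I).Mem b

/-- Every object has a special `J`-preenvelope. -/
def SpecialPreenveloping (J : MorIdeal C) : Prop :=
  ∀ B : C, ∃ (C₀ : C) (j : B ⟶ C₀), E.IsSpecialPreenvelope J j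

/-- Every object has a special `I`-precover. -/
def SpecialPrecovering (I : MorIdeal C) : Prop :=
  ∀ A : C, ∃ (C₁ : C) (i : C₁ ⟶ A), E.IsSpecialPrecover I i

/-- `(I, J)` is an ideal cotorsion pair: `I = ^⊥J` and `J = I^⊥`. -/
def IsCotorsionPair (I J : MorIdeal C) : Prop :=
  I = E.leftPerp J ∧ J = E.rightPerp I

/-- An ideal cotorsion pair `(I, J)` is complete if `I` is special precovering and `J` is special
preenveloping. -/
def IsCompleteCotorsionPair (I J : MorIdeal C) : Prop :=
  E.IsCotorsionPair I J ∧ E.SpecialPrecovering I ∧ E.SpecialPreenveloping J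

/-- `c = b ⋆ a` is an ME-extension of the arrow `a` by the arrow `b`: there is a commutative
diagram with conflations as rows
```
  B₀ ⟶ C₀ ⟶ A₀
  ‖     ↓c₁   ↓a
  B₀ ⟶ D  ⟶ A₁
  ↓b    ↓c₂   ‖
  B₁ ⟶ C₁ ⟶ A₁
```
and `c = c₁ ≫ c₂`. -/
def IsMEExtension {B₀ B₁ C₀ C₁ A₀ A₁ : C} (b : B₀ ⟶ B₁) (c : C₀ ⟶ C₁) (a : A₀ ⟶ A₁) : Prop :=
  ∃ (D : C) (m₀ : B₀ ⟶ C₀) (p₀ : C₀ ⟶ A₀) (m : B₀ ⟶ D) (p : D ⟶ A₁)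
    (m₁ : B₁ ⟶ C₁) (p₁ : C₁ ⟶ A₁) (c₁ : C₀ ⟶ D) (c₂ : D ⟶ C₁),
    E.conf m₀ p₀ ∧ E.conf m p ∧ E.conf m₁ p₁ ∧
    m₀ ≫ c₁ = m ∧ p₀ ≫ a = c₁ ≫ p ∧
    m ≫ c₂ = b ≫ m₁ ∧ p = c₂ ≫ p₁ ∧ c = c₁ ≫ c₂

/-- `I ◇ K`: the ideal generated by the ME-extensions `i ⋆ k` of morphisms `k ∈ K` by morphisms
`i ∈ I`. -/
def diamond (I K : MorIdeal C) : MorIdeal C :=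
  MorIdeal.span fun _ _ c => ∃ (B₀ B₁ A₀ A₁ : C) (i : B₀ ⟶ B₁) (k : A₀ ⟶ A₁),
    I.Mem i ∧ K.Mem k ∧ E.IsMEExtension i c k

end ExactStructure

end IdealApprox

namespace IdealApprox

variable {C : Type u} [Category.{v} C] [Preadditive C]

/-! ### Sums of ideals. -/

namespace MorIdeal

/-! Put K = I₁ + I₂ and let J be the intersection of the two right orthogonals. Left orthogonality
to a fixed morphism survives sums, so J = K^⊥.

Extending by projective morphisms does not change this right orthogonal (`rightPerp_diamond_proj`).
For an ME-extension q ⋆ a with q projective, an extension pulled back to the middle row splits over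
the left end of that row, so it comes from the right end, where orthogonality of a applies.

J is special preenveloping. Because there are enough injective morphisms, the two given preenvelope
diagrams of B map to one conflation B → Q → S. Pulling that conflation back along the combined map
to S, and then along a₁ ⊕ a₂, gives an inflation that factors through both preenvelopes. Its
cokernel component a₁ ⊕ a₂ lies in K itself, not merely in ^⊥J.

That refinement feeds Salce's construction: pushing such a preenvelope of the kernel of a projective
deflation p onto A out along that kernel gives a special precover of A factoring through p ⋆ a.
Finally, a special precovering ideal equals the left orthogonal of its right orthogonal
(`SpecialPrecovering.eq_leftPerp_rightPerp`), which supplies the remaining identity. -/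

theorem Mem.comp {I : MorIdeal C} {W X Y Z : C} {a : X ⟶ Y} (h : I.Mem a) (f : W ⟶ X)
    (g : Y ⟶ Z) : I.Mem (f ≫ a ≫ g) := I.comp_mem f g h

theorem ext_mem {I J : MorIdeal C}
    (h : ∀ {X Y : C} (a : X ⟶ Y), I.Mem a ↔ J.Mem a) : I = J := by
  ext X Y a
  exact h a

theorem mem_add_iff {I J : MorIdeal C} {X Y : C} {a : X ⟶ Y} :
    (I + J).Mem a ↔ ∃ x y : X ⟶ Y, I.Mem x ∧ J.Mem y ∧ x + y = a := by
  refine AddSubgroup.mem_sup.trans ⟨?_, ?_⟩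
  · rintro ⟨x, hx, y, hy, h⟩
    exact ⟨x, y, hx, hy, h⟩
  · rintro ⟨x, y, hx, hy, h⟩
    exact ⟨x, hx, y, hy, h⟩

theorem mem_add_left {I J : MorIdeal C} {X Y : C} {a : X ⟶ Y} (h : I.Mem a) : (I + J).Mem a :=
  mem_add_iff.2 ⟨a, 0, h, (J.hom X Y).zero_mem, add_zero a⟩

theorem mem_add_right {I J : MorIdeal C} {X Y : C} {a : X ⟶ Y} (h : J.Mem a) : (I + J).Mem a :=
  mem_add_iff.2 ⟨0, a, (I.hom X Y).zero_mem, h, zero_add a⟩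

/-- The block map is the sum of its diagonal entries, each factoring through one of the two
morphisms. -/
theorem biprod_map_mem_add [HasBinaryBiproducts C] {I J : MorIdeal C} {X Y X' Y' : C}
    {a : X ⟶ Y} {a' : X' ⟶ Y'} (h : I.Mem a) (h' : J.Mem a') :
    (I + J).Mem (biprod.map a a') := by
  refine mem_add_iff.2 ⟨biprod.fst ≫ a ≫ biprod.inl, biprod.snd ≫ a' ≫ biprod.inr,
    h.comp _ _, h'.comp _ _, ?_⟩
  apply biprod.hom_ext' <;> apply biprod.hom_ext <;> simp

end MorIdeal

variable [HasZeroObject C] [HasBinaryBiproducts C]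

/-! ### Orthogonality of ME-extensions by projective morphisms. -/

namespace ExactStructure

variable {E : ExactStructure C}

/-- The axiom speaks of one pushout only; any other is isomorphic to it. -/
theorem Inflation.of_isPushout {X Y X' Y' : C} {m : X ⟶ Y} {f : X ⟶ X'} {g : Y ⟶ Y'}
    {m' : X' ⟶ Y'} (h : IsPushout m f g m') (hm : E.Inflation m) : E.Inflation m' := by
  obtain ⟨Y'', g', n, hpo, W, q, hq⟩ := E.pushout_inflation m f hm
  have e : n ≫ (hpo.isoIsPushout _ _ h).hom = m' := hpo.inr_isoIsPushout_hom _ _ h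
  exact ⟨W, (hpo.isoIsPushout _ _ h).inv ≫ q,
    E.iso_closed (Iso.refl _) (hpo.isoIsPushout _ _ h) (Iso.refl _) (by simp [e])
      (by simp) hq⟩

/-- If the pullback along the inflation `m` of an extension `X` becomes split after pushing out
along `b`, then the pushout of `X` along `b` is pulled back from an extension of the cokernel of `m`. -/
theorem Extension.exists_of_pullback_push_split {K D A B B' : C} {m : K ⟶ D} {p : D ⟶ A}
    (hmp : E.conf m p) (X : E.Extension D B) {P : E.Extension K B}
    (hP : IsPullbackOf m P X) {b : B ⟶ B'} (r : P.mid ⟶ B') (hr : P.i ≫ r = b) :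
    ∃ (Y : E.Extension A B') (h : X.mid ⟶ Y.mid), X.i ≫ h = b ≫ Y.i ∧ h ≫ Y.p = X.p ≫ p := by
  obtain ⟨g, hg, hpb⟩ := hP
  have hm := E.pair hmp
  have := hm.mono
  have : Mono g := ⟨fun u v huv => hpb.hom_ext huv <| by
    rw [← cancel_mono m, Category.assoc, Category.assoc, ← hpb.w, reassoc_of% huv]⟩
  -- The kernel of `X.mid ⟶ D ⟶ A` is the preimage of `K`, which is `P.mid`.
  have hconf : E.conf g (X.p ≫ p) := by
    refine Deflation.conf_of_kernel
      (E.comp_deflation X.p p ⟨_, _, X.conf⟩ ⟨_, _, hmp⟩) ?_ ?_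
    · rw [← Category.assoc, hpb.w, Category.assoc, hm.w, comp_zero]
    · intro W k hk
      obtain ⟨l, hl⟩ := hm.exists_lift (k ≫ X.p) (by rw [Category.assoc, hk])
      exact ⟨hpb.lift k l hl.symm, hpb.lift_fst _ _ _⟩
  -- Pushing out along `r` restricts on `B` to pushing out along `b`, since `P.i ≫ r = b`.
  obtain ⟨Y, h, hh, hpo⟩ := exists_pushout r (⟨_, _, _, hconf⟩ : E.Extension A P.mid)
  exact ⟨Y, h, by rw [← hg, Category.assoc, hpo.w, ← Category.assoc, hr], hh⟩

/-- An ME-extension of `a` by a projective morphism is left orthogonal to everything that `a` is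
left orthogonal to. -/
theorem ExtOrthogonal.of_isMEExtension {K₀ K₁ C₀ C₁ A₀ A₁ B₀ B₁ : C} {q : K₀ ⟶ K₁}
    {c : C₀ ⟶ C₁} {a : A₀ ⟶ A₁} {b : B₀ ⟶ B₁} (hq : E.proj.Mem q)
    (hc : E.IsMEExtension q c a) (h : E.ExtOrthogonal a b) : E.ExtOrthogonal c b := by
  obtain ⟨D, m₀, p₀, m, p, m₁, p₁, c₁, c₂, h₀, hmp, h₁, -, e₂, e₃, -, rfl⟩ := hc
  rw [extOrthogonal_iff] at *
  intro X X' ⟨x, hx, hpb⟩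
  -- `X₂` lives over `D`. It descends to `A₁` once its restriction `P` to `K₀` splits.
  obtain ⟨X₂, y, hy, hpb₂⟩ := Extension.exists_pullback c₂ X
  obtain ⟨P, hP⟩ := Extension.exists_pullback m X₂
  obtain ⟨S, s, hs, hpbS⟩ := Extension.exists_pullback m₁ X
  obtain ⟨T, hT⟩ := Extension.exists_pullback q S
  -- Orthogonality of `q` to the identity says that `T` itself splits, with retraction `ρ`.
  obtain ⟨ρ, hρ⟩ := (extOrthogonal_iff q (𝟙 B₀)).1 (hq (𝟙 B₀) trivial) S T hT
  obtain ⟨t, ht, hpbT⟩ := hT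
  have hP' := hP
  obtain ⟨z, hz, hpbP⟩ := hP'
  -- Since `m ≫ c₂ = q ≫ m₁`, both `P` and `T` are the restriction of `X` to `K₀`; the comparison
  -- map transports `ρ` to `P`.
  have w₁ : (z ≫ y) ≫ X.p = (P.p ≫ q) ≫ m₁ := by
    rw [Category.assoc, hpb₂.w, ← Category.assoc, hpbP.w, Category.assoc, e₃, Category.assoc]
  have w₂ : hpbS.lift _ _ w₁ ≫ S.p = P.p ≫ q := hpbS.lift_snd _ _ _
  have e : P.i ≫ hpbT.lift _ _ w₂ = T.i := by
    apply hpbT.hom_ext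
    · apply hpbS.hom_ext
      · simp [reassoc_of% hz, hy, ht, hs]
      · simp [reassoc_of% (E.pair P.conf).w, reassoc_of% ht, (E.pair S.conf).w]
    · simp [(E.pair P.conf).w, (E.pair T.conf).w]
  obtain ⟨Y, k, hk, hk'⟩ := Extension.exists_of_pullback_push_split hmp X₂ hP
    (hpbT.lift _ _ w₂ ≫ ρ) (by rw [reassoc_of% e, hρ])
  rw [Category.id_comp] at hk
  obtain ⟨Y', hY'⟩ := Extension.exists_pullback a Y
  obtain ⟨r, hr⟩ := h Y Y' hY'
  obtain ⟨g, hg, hpbY⟩ := hY'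
  -- Because `p₀ ≫ a = c₁ ≫ p`, `X'` maps through `X₂` and `Y` to `Y'`, identically on the left end,
  -- so `r` restricts to the required extension of `b`.
  have w₃ : x ≫ X.p = (X'.p ≫ c₁) ≫ c₂ := by rw [hpb.w, Category.assoc]
  have w₄ : (hpb₂.lift _ _ w₃ ≫ k) ≫ Y.p = (X'.p ≫ p₀) ≫ a := by
    rw [Category.assoc, hk', ← Category.assoc, hpb₂.lift_snd, Category.assoc, Category.assoc,
      e₂]
  have e₅ : X'.i ≫ hpb₂.lift _ _ w₃ = X₂.i := by
    apply hpb₂.hom_ext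
    · simp [hx, hy]
    · simp [reassoc_of% (E.pair X'.conf).w, (E.pair X₂.conf).w]
  refine ⟨hpbY.lift _ _ w₄ ≫ r, ?_⟩
  have e₆ : X'.i ≫ hpbY.lift _ _ w₄ = Y'.i := by
    apply hpbY.hom_ext
    · simp [reassoc_of% e₅, hk, hg]
    · simp [reassoc_of% (E.pair X'.conf).w, (E.pair Y'.conf).w]
  rw [reassoc_of% e₆, hr]

/-- For fixed `b`, the morphisms left orthogonal to `b` are closed under addition. -/
theorem rightPerp_add (I₁ I₂ : MorIdeal C) :
    E.rightPerp (I₁ + I₂) = E.rightPerp I₁ ⊓ E.rightPerp I₂ := by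
  refine MorIdeal.ext_mem fun b => ⟨fun h => ⟨?_, ?_⟩, ?_⟩
  · exact fun a ha => h a (MorIdeal.mem_add_left ha)
  · exact fun a ha => h a (MorIdeal.mem_add_right ha)
  · rintro ⟨h₁, h₂⟩ A₀ A₁ a ha
    obtain ⟨x, y, hx, hy, rfl⟩ := MorIdeal.mem_add_iff.1 ha
    exact (h₁ x hx).add_left (h₂ y hy)

/-- Every morphism is an ME-extension of itself by a zero morphism. -/
theorem mem_diamond_of_mem {I K : MorIdeal C} {A₀ A₁ : C} {a : A₀ ⟶ A₁} (ha : K.Mem a) :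
    (E.diamond I K).Mem a := by
  -- `a` is a corner of the split ME-extension `0 ⊕ a`. The left end `A₀` is an arbitrary choice.
  refine AddSubgroup.subset_closure ⟨_, _, biprod.inr, biprod.map (0 : A₀ ⟶ A₀) a, biprod.snd,
    ⟨A₀, A₀, A₀, A₁, 0, a, (I.hom _ _).zero_mem, ha, ?_⟩, by simp⟩
  refine ⟨A₀ ⊞ A₁, biprod.inl, biprod.snd, biprod.inl, biprod.snd, biprod.inl, biprod.snd,
    biprod.map (𝟙 _) a, biprod.map 0 (𝟙 _), E.conf_biprod _ _, E.conf_biprod _ _,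
    E.conf_biprod _ _, ?_, ?_, ?_, ?_, ?_⟩
  · simp
  · simp
  · simp
  · simp
  · apply biprod.hom_ext' <;> simp

/-- The diamond contains `K`, and its generators inherit every orthogonality of their `K`-part; sums
and composites preserve it. -/
theorem rightPerp_diamond_proj (K : MorIdeal C) :
    E.rightPerp (E.diamond E.proj K) = E.rightPerp K := by
  refine MorIdeal.ext_mem fun b => ⟨fun h _ _ a ha => h a (mem_diamond_of_mem ha), ?_⟩
  intro h A₀ A₁ a ha
  have ha' : a ∈ AddSubgroup.closure _ := ha
  induction ha' using AddSubgroup.closure_induction with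
  | mem x hx =>
    obtain ⟨_, _, f, c, g, ⟨_, _, _, _, q, k, hq, hk, hc⟩, rfl⟩ := hx
    exact ((h k hk).of_isMEExtension hq hc).comp_left f g
  | zero => exact extOrthogonal_zero_left _ _ b
  | add x y hx hy hx' hy' => exact (hx' hx).add_left (hy' hy)
  | neg x hx hx' => exact (hx' hx).neg_left

/-! ### Special preenvelopes for an intersection. -/

/-- A morphism out of the left end of an extension that is an injective morphism extends to the
middle term. -/
theorem inj_extend {A B Q : C} {e : B ⟶ Q} (he : E.inj.Mem e) (X : E.Extension A B) :
    ∃ g : X.mid ⟶ Q, X.i ≫ g = e :=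
  -- `X` is its own pullback along the identity.
  (extOrthogonal_iff (𝟙 A) e).1 (he (𝟙 A) trivial) X X
    ⟨𝟙 _, by simp, IsPullback.of_horiz_isIso ⟨by simp⟩⟩

/-- A special preenvelope for `J₁ ⊓ J₂`, with the cokernel component in `^⊥J₁ + ^⊥J₂`. -/
theorem exists_inflation_of_specialPreenvelopes (hinj : E.EnoughInjectiveMorphisms)
    {J₁ J₂ : MorIdeal C} (h₁ : E.SpecialPreenveloping J₁) (h₂ : E.SpecialPreenveloping J₂)
    (B : C) :
    ∃ (A₀ A₁ : C) (a : A₀ ⟶ A₁) (X : E.Extension A₀ B) (X' : E.Extension A₁ B)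
      (g : X.mid ⟶ X'.mid), (J₁ ⊓ J₂).Mem X.i ∧ X.i ≫ g = X'.i ∧ X.p ≫ a = g ≫ X'.p ∧
      (E.leftPerp J₁ + E.leftPerp J₂).Mem a := by
  obtain ⟨Q, e, ⟨S, q, heq⟩, he⟩ := hinj B
  have hS := E.pair heq
  obtain ⟨C₁, j₁, hj₁, A₁, D₁, A₁', p₁, i₁, p₁', c₁, a₁, h₁₁, h₁₂, h₁₃, h₁₄, h₁₅⟩ := h₁ B
  obtain ⟨C₂, j₂, hj₂, A₂, D₂, A₂', p₂, i₂, p₂', c₂, a₂, h₂₁, h₂₂, h₂₃, h₂₄, h₂₅⟩ := h₂ B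
  obtain ⟨g₁, hg₁⟩ := inj_extend he ⟨_, _, _, h₁₂⟩
  obtain ⟨g₂, hg₂⟩ := inj_extend he ⟨_, _, _, h₂₂⟩
  dsimp only at g₁ g₂ hg₁ hg₂
  -- The maps on cokernels `f₁`, `f₂` present both lower conflations over the single conflation `B ⟶
  -- Q ⟶ S`.
  obtain ⟨f₁, hf₁⟩ := (E.pair h₁₂).exists_desc (g₁ ≫ q) (by rw [reassoc_of% hg₁, hS.w])
  obtain ⟨f₂, hf₂⟩ := (E.pair h₂₂).exists_desc (g₂ ≫ q) (by rw [reassoc_of% hg₂, hS.w])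
  obtain ⟨X', y, hy, hpb'⟩ := Extension.exists_pullback (biprod.desc f₁ f₂)
    (⟨Q, e, q, heq⟩ : E.Extension S B)
  obtain ⟨X, g, hg, hpb⟩ := Extension.exists_pullback (biprod.map a₁ a₂) X'
  dsimp only at y hy hpb'
  -- These compatibilities produce maps from `C₁` and `C₂` into `X'.mid`, and below into `X.mid`,
  -- through the respective summands; `s₁` and `s₂` then show that `X.i` factors through `j₁` and
  -- `j₂`.
  have u₁ : (c₁ ≫ g₁) ≫ q = (p₁ ≫ a₁ ≫ biprod.inl) ≫ biprod.desc f₁ f₂ := by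
    simp [← hf₁, reassoc_of% h₁₄]
  have u₂ : (c₂ ≫ g₂) ≫ q = (p₂ ≫ a₂ ≫ biprod.inr) ≫ biprod.desc f₁ f₂ := by
    simp [← hf₂, reassoc_of% h₂₄]
  have v₁ : hpb'.lift _ _ u₁ ≫ X'.p = (p₁ ≫ biprod.inl) ≫ biprod.map a₁ a₂ := by simp
  have v₂ : hpb'.lift _ _ u₂ ≫ X'.p = (p₂ ≫ biprod.inr) ≫ biprod.map a₁ a₂ := by simp
  have s₁ : j₁ ≫ hpb.lift _ _ v₁ = X.i := by
    apply hpb.hom_ext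
    · apply hpb'.hom_ext
      · simp [reassoc_of% h₁₃, hg₁, hg, hy]
      · simp [reassoc_of% (E.pair h₁₁).w, hg, (E.pair X'.conf).w]
    · simp [reassoc_of% (E.pair h₁₁).w, (E.pair X.conf).w]
  have s₂ : j₂ ≫ hpb.lift _ _ v₂ = X.i := by
    apply hpb.hom_ext
    · apply hpb'.hom_ext
      · simp [reassoc_of% h₂₃, hg₂, hg, hy]
      · simp [reassoc_of% (E.pair h₂₁).w, hg, (E.pair X'.conf).w]
    · simp [reassoc_of% (E.pair h₂₁).w, (E.pair X.conf).w]
  refine ⟨_, _, biprod.map a₁ a₂, X, X', g, ⟨?_, ?_⟩, hg, hpb.w.symm,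
    MorIdeal.biprod_map_mem_add h₁₅ h₂₅⟩
  · rw [← s₁]
    simpa [MorIdeal.Mem] using MorIdeal.Mem.comp hj₁ (𝟙 B) (hpb.lift _ _ v₁)
  · rw [← s₂]
    simpa [MorIdeal.Mem] using MorIdeal.Mem.comp hj₂ (𝟙 B) (hpb.lift _ _ v₂)

/-! ### Salce's construction. -/

/-- Salce's construction: a special preenvelope of the kernel of a projective deflation onto `A`
whose cokernel component lies in `K` yields a special precover of `A` by a morphism in
`proj ◇ K`. -/
theorem exists_specialPrecover_diamond {K : MorIdeal C} {A L P : C} {k : L ⟶ P} {p : P ⟶ A}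
    (hkp : E.conf k p) (hp : E.proj.Mem p) {A₀ A₁ : C} {a : A₀ ⟶ A₁} (X : E.Extension A₀ L)
    (X' : E.Extension A₁ L) (g : X.mid ⟶ X'.mid) (hX : (E.rightPerp K).Mem X.i)
    (hg : X.i ≫ g = X'.i) (hga : X.p ≫ a = g ≫ X'.p) (ha : K.Mem a) :
    ∃ (W : C) (i : W ⟶ A), E.IsSpecialPrecover (E.diamond E.proj K) i := by
  have hL := E.pair hkp
  have := hL.epi
  obtain ⟨W, h, hh, hpo⟩ := Extension.exists_pushout k X
  obtain ⟨W', h', hh', hpo'⟩ := Extension.exists_pushout k X'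
  have w : X.i ≫ (0 : X.mid ⟶ A) = k ≫ p := by rw [hL.w, comp_zero]
  have w' : X'.i ≫ (0 : X'.mid ⟶ A) = k ≫ p := by rw [hL.w, comp_zero]
  have wf : X.i ≫ (g ≫ h') = k ≫ W'.i := by rw [← Category.assoc, hg, hpo'.w]
  -- `V` is the bottom row of the ME-extension `p ⋆ a`. It splits because `p` extends to `W'.mid` by
  -- zero on `X'.mid`; composing with the retraction onto `A` recovers the precover.
  obtain ⟨V, t, ht, hpoV⟩ := Extension.exists_pushout p W'
  have wV : W'.i ≫ hpo'.desc 0 p w' = p ≫ 𝟙 A := by simp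
  have hi : hpo.desc 0 p w
      = 𝟙 _ ≫ (hpo.desc (g ≫ h') W'.i wf ≫ t) ≫ hpoV.desc _ _ wV := by
    apply hpo.hom_ext <;> simp
  have hME : E.IsMEExtension p (hpo.desc (g ≫ h') W'.i wf ≫ t) a := by
    refine ⟨W'.mid, W.i, W.p, W'.i, W'.p, V.i, V.p, hpo.desc (g ≫ h') W'.i wf, t, W.conf,
      W'.conf, V.conf, by simp, ?_, hpoV.w, ht.symm, rfl⟩
    apply hpo.hom_ext
    · simp [reassoc_of% hh, hga, hh']
    · simp [reassoc_of% (E.pair W.conf).w, (E.pair W'.conf).w]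
  have : Epi (hpo.desc 0 p w) := by
    have : Epi (W.i ≫ hpo.desc 0 p w) := by rw [hpo.inr_desc]; infer_instance
    exact epi_of_epi W.i _
  -- In the pushout square `h` is also the pushout of `k`, so it is an inflation with the same
  -- cokernel `A`.
  have hconf : E.conf h (hpo.desc 0 p w) := by
    refine Inflation.conf_of_cokernel (Inflation.of_isPushout hpo.flip ⟨_, _, hkp⟩)
      (hpo.inl_desc _ _ _) fun l hl => ?_
    obtain ⟨d, hd⟩ := hL.exists_desc (W.i ≫ l) (by rw [← hpo.w_assoc, hl, comp_zero])
    refine ⟨d, hpo.hom_ext ?_ ?_⟩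
    · simp [hl]
    · simp [hd]
  refine ⟨W.mid, hpo.desc 0 p w, ?_, L, P, X.mid, k, p, h, X.i, W.i, hkp, hconf, hpo.w.symm,
    hpo.inr_desc _ _ _, ?_⟩
  · exact AddSubgroup.subset_closure ⟨_, _, _, _, _, ⟨_, _, _, _, p, a, hp, ha, hME⟩, hi⟩
  · rwa [rightPerp_diamond_proj]

/-! ### From special precovers to the cotorsion pair. -/

/-- A special precovering ideal is determined by its right orthogonal. -/
theorem SpecialPrecovering.eq_leftPerp_rightPerp {I : MorIdeal C} (h : E.SpecialPrecovering I) :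
    I = E.leftPerp (E.rightPerp I) := by
  refine MorIdeal.ext_mem fun {A' A} a => ⟨fun ha _ _ b hb => hb a ha, fun ha => ?_⟩
  obtain ⟨C₁, i, hi, B₀, C₀, B₁, m₀, p₀, m₁, b, c, h₀, h₁, e₁, e₂, hb⟩ := h A
  -- Orthogonality of `a` to `b` lifts `a` through the pushout along `b`, which maps to `C₁` over
  -- `A`; hence `a` factors through `i`.
  obtain ⟨Z, hZ⟩ := Extension.exists_pushout b (⟨C₀, m₀, p₀, h₀⟩ : E.Extension A B₀)
  obtain ⟨t, ht⟩ := (extOrthogonal_iff' a b).1 (ha b hb) _ Z hZ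
  obtain ⟨z, hz, hpo⟩ := hZ
  dsimp only at z hz hpo
  have e : hpo.desc c m₁ e₁ ≫ i = Z.p := by
    apply hpo.hom_ext
    · simp [e₂, hz]
    · simp [(E.pair h₁).w, (E.pair Z.conf).w]
  have : a = (t ≫ hpo.desc c m₁ e₁) ≫ i ≫ 𝟙 A := by simp [e, ht]
  rw [this]
  exact hi.comp _ _

end ExactStructure

end IdealApprox

theorem corollaryC {C : Type u} [Category.{v} C] [Preadditive C] [HasZeroObject C] [HasBinaryBiproducts C]
    (E : IdealApprox.ExactStructure C)
    (hproj : E.EnoughProjectiveMorphisms) (hinj : E.EnoughInjectiveMorphisms)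
    (I₁ I₂ : IdealApprox.MorIdeal C)
    (h₁ : E.IsCompleteCotorsionPair I₁ (E.rightPerp I₁))
    (h₂ : E.IsCompleteCotorsionPair I₂ (E.rightPerp I₂)) :
    E.IsCompleteCotorsionPair (E.diamond E.proj (I₁ + I₂))
      (E.rightPerp I₁ ⊓ E.rightPerp I₂) := by
  have hperp := IdealApprox.ExactStructure.rightPerp_add (E := E) I₁ I₂
  have henv := IdealApprox.ExactStructure.exists_inflation_of_specialPreenvelopes hinj
    h₁.2.2 h₂.2.2
  -- The identities `Iⱼ = ^⊥(Iⱼ^⊥)` place the cokernel component in `I₁ + I₂`.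
  rw [← h₁.1.1, ← h₂.1.1, ← hperp] at henv
  rw [← hperp]
  have hcov : E.SpecialPrecovering (E.diamond E.proj (I₁ + I₂)) := by
    intro A
    obtain ⟨P, p, ⟨L, k, hkp⟩, hp⟩ := hproj A
    obtain ⟨A₀, A₁, a, X, X', g, hX, hg, hga, ha⟩ := henv L
    exact IdealApprox.ExactStructure.exists_specialPrecover_diamond hkp hp X X' g hX hg hga ha
  refine ⟨⟨?_, (IdealApprox.ExactStructure.rightPerp_diamond_proj _).symm⟩, hcov, ?_⟩
  · conv_lhs => rw [hcov.eq_leftPerp_rightPerp]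
    rw [IdealApprox.ExactStructure.rightPerp_diamond_proj]
  -- The component lies in `I₁ + I₂`, hence in the left orthogonal of its right orthogonal.
  · intro B
    obtain ⟨A₀, A₁, a, X, X', g, hX, hg, hga, ha⟩ := henv B
    exact ⟨X.mid, X.i, hX, A₀, X'.mid, A₁, X.p, X'.i, X'.p, g, a, X.conf, X'.conf, hg, hga,
      fun b hb => hb a ha⟩
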